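/- Let $I$ be a finite set and let $\Delta$ be a building over $I$ of right-angled type $M=(m_{ij})_{i,j\in I}$, i.e. $m_{ij}\in\{2,\infty\}$ for all $i\neq j$, viewed as a chamber system. Suppose that $\Delta$ is semiregular with (possibly infinite) parameters $(q_i)_{i\in I}$: every $i$-panel has exactly $q_i\ge 2$ chambers. Let $X_i$ be sets with $|X_i|=q_i$ and let $\lambda=(\lambda_i)_{i\in I}\colon\Delta\to\prod_{i\in I}X_i$ be a legal colouring, i.e. on every $i$-panel $\mathcal P$ the restriction $\lambda_i|_{\mathcal P}\colon\mathcal P\to X_i$ is a bijection and $\lambda_j|_{\mathcal P}$ is constant for each $j\ne i$. For every $i\in I$ let $F_i\le\operatorname{Sym}(X_i)$ be an arbitrary permutation group, and let $$U=U_\Delta^\lambda(\boldsymbol F)=\{g\in\operatorname{Aut}(\Delta) : \lambda_i|_{g\mathcal P}\circ g|_{\mathcal P}\circ(\lambda_i|_{\mathcal P})^{-1}\in F_i\text{ for every }i\in I\text{ and every }i\text{-panel }\mathcal P\},$$ where $\operatorname{Aut}(\Delta)$ is the group of type-preserving automorphisms. Let $U^+$ be the subgroup of $U$ generated by all stabilisers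 in $U$ of chambers of $\Delta$. Then the following are equivalent: (i) $U^+=U$; (ii) for every $i\in I$ the group $F_i$ is generated by its point stabilisers $(F_i)_x$, $x\in X_i$, and there is a subset $V\subseteq I$ such that for all $i,j\in I$ with $m_{ij}=\infty$ one has $i\in V$ or $j\in V$ (that is, $V$ is a vertex cover of the diagram), and $F_i$ is transitive on $X_i$ for every $i\in V$. -/

import Mathlib

/-- A chamber system over `I` with chamber set `C`: for each `i : I` an equivalence relation on `C`,
called `i`-adjacency. Its classes are the `i`-panels. -/
structure ChamberSystem (I : Type*) (C : Type*) where
  adj : I → Setoid C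

namespace ChamberSystem

/-- The `i`-panel containing the chamber `c`. -/
def panel {I C : Type*} (D : ChamberSystem I C) (i : I) (c : C) : Set C :=
  {d | (D.adj i).r c d}

/-- `D.Gallery w x y`: there is a gallery of type `w` from `x` to `y`, that is, a sequence of
chambers in which each chamber is adjacent to, and distinct from, the next one. -/
def Gallery {I C : Type*} (D : ChamberSystem I C) : List I → C → C → Prop
  | [], x, y => x = y
  | i :: w, x, y => ∃ z, (D.adj i).r x z ∧ x ≠ z ∧ D.Gallery w z y

/-- A building of type `M`: a non-empty chamber system in which every panel has at least two
chambers, with a Weyl-group-valued distance `δ` such that, for every reduced word `w`, one has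
`δ x y = r_w` if and only if `x` and `y` are joined by a gallery of type `w`.
(In a `CoxeterMatrix`, the entry `0` stands for `∞`.) -/
structure IsBuilding {I C : Type*} (D : ChamberSystem I C) (M : CoxeterMatrix I) : Prop where
  nonempty : Nonempty C
  panel_nontrivial : ∀ (i : I) (c : C), (D.panel i c).Nontrivial
  exists_dist : ∃ δ : C → C → M.Group, ∀ w : List I, M.toCoxeterSystem.IsReduced w →
    ∀ x y : C, δ x y = M.toCoxeterSystem.wordProd w ↔ D.Gallery w x y

/-- The group of (type-preserving) automorphisms. -/
def Aut {I C : Type*} (D : ChamberSystem I C) : Subgroup (Equiv.Perm C) where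
  carrier := {g | ∀ i x y, (D.adj i).r (g x) (g y) ↔ (D.adj i).r x y}
  one_mem' := fun _ _ _ => Iff.rfl
  mul_mem' := fun {g h} hg hh i x y => (hg i (h x) (h y)).trans (hh i x y)
  inv_mem' := fun {g} hg i x y => by
    have h := hg i (g⁻¹ x) (g⁻¹ y)
    simpa using h.symm

/-- The bijection from the panel `P` of `c` to the panel `g P` of `g c` induced by `g`. -/
def panelEquiv {I C : Type*} (D : ChamberSystem I C) (g : D.Aut) (i : I) (c : C) :
    D.panel i c ≃ D.panel i (g.1 c) :=
  g.1.subtypeEquiv fun d => (g.2 i c d).symm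

/-- A legal colouring with colour sets `X i`: on every `i`-panel, the `i`-colour is a bijection
onto `X i` and, for `j ≠ i`, the `j`-colour is constant. In particular all `i`-panels have the
same cardinality, that of `X i`. -/
structure LegalColouring {I C : Type*} (D : ChamberSystem I C) (X : I → Type*) where
  col : C → ∀ i, X i
  bijective : ∀ (i : I) (c : C), Function.Bijective fun d : D.panel i c => col d.1 i
  constant : ∀ (i j : I), j ≠ i → ∀ c : C, ∀ d ∈ D.panel i c, col d j = col c j

namespace LegalColouring

/-- The `i`-colour, as a bijection from the `i`-panel of `c` to `X i`. -/
noncomputable def panelColour {I C : Type*} {D : ChamberSystem I C} {X : I → Type*}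
    (L : D.LegalColouring X) (i : I) (c : C) : D.panel i c ≃ X i :=
  Equiv.ofBijective _ (L.bijective i c)

/-- The local action `λ_i|_{gP} ∘ g|_P ∘ (λ_i|_P)⁻¹` of `g` at the `i`-panel `P` containing `c`. -/
noncomputable def localAction {I C : Type*} {D : ChamberSystem I C} {X : I → Type*}
    (L : D.LegalColouring X) (g : D.Aut) (i : I) (c : C) : Equiv.Perm (X i) :=
  (L.panelColour i c).symm.trans ((D.panelEquiv g i c).trans (L.panelColour i (g.1 c)))

theorem localAction_col {I C : Type*} {D : ChamberSystem I C} {X : I → Type*}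
    (L : D.LegalColouring X) (g : D.Aut) (i : I) (c : C) (d : C) (hd : d ∈ D.panel i c) :
    L.localAction g i c (L.col d i) = L.col (g.1 d) i := by
  have h : (L.panelColour i c).symm (L.col d i) = ⟨d, hd⟩ := by
    rw [Equiv.symm_apply_eq]; rfl
  simp only [localAction, Equiv.trans_apply, h]
  rfl

theorem exists_col_eq {I C : Type*} {D : ChamberSystem I C} {X : I → Type*}
    (L : D.LegalColouring X) (i : I) (c : C) (x : X i) : ∃ d ∈ D.panel i c, L.col d i = x := by
  obtain ⟨⟨d, hd⟩, h⟩ := (L.bijective i c).2 x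
  exact ⟨d, hd, h⟩

theorem localAction_one {I C : Type*} {D : ChamberSystem I C} {X : I → Type*}
    (L : D.LegalColouring X) (i : I) (c : C) : L.localAction 1 i c = 1 := by
  ext x
  obtain ⟨d, hd, rfl⟩ := L.exists_col_eq i c x
  rw [L.localAction_col 1 i c d hd]
  rfl

theorem localAction_mul {I C : Type*} {D : ChamberSystem I C} {X : I → Type*}
    (L : D.LegalColouring X) (g h : D.Aut) (i : I) (c : C) :
    L.localAction (g * h) i c = L.localAction g i (h.1 c) * L.localAction h i c := by
  ext x
  obtain ⟨d, hd, rfl⟩ := L.exists_col_eq i c x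
  rw [L.localAction_col _ i c d hd, Equiv.Perm.mul_apply, L.localAction_col h i c d hd,
    L.localAction_col g i _ _ ((h.2 i c d).2 hd)]
  rfl

theorem localAction_inv {I C : Type*} {D : ChamberSystem I C} {X : I → Type*}
    (L : D.LegalColouring X) (g : D.Aut) (i : I) (c : C) :
    L.localAction g⁻¹ i c = (L.localAction g i ((g⁻¹).1 c))⁻¹ := by
  have h := L.localAction_mul g g⁻¹ i c
  rw [mul_inv_cancel, L.localAction_one] at h
  exact eq_inv_of_mul_eq_one_right h.symm

/-- The universal group with local groups `F i`: all automorphisms whose local action at every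
`i`-panel lies in `F i`. -/
noncomputable def universalGroup {I C : Type*} {D : ChamberSystem I C} {X : I → Type*}
    (L : D.LegalColouring X) (F : ∀ i, Subgroup (Equiv.Perm (X i))) : Subgroup D.Aut where
  carrier := {g | ∀ i c, L.localAction g i c ∈ F i}
  one_mem' := fun i c => by rw [L.localAction_one]; exact (F i).one_mem
  mul_mem' := fun {g h} hg hh i c => by
    rw [L.localAction_mul]; exact (F i).mul_mem (hg i _) (hh i c)
  inv_mem' := fun {g} hg i c => by
    rw [L.localAction_inv]; exact (F i).inv_mem (hg i _)

end LegalColouring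

end ChamberSystem

/-- `M` is right-angled: `m_{ij} ∈ {2, ∞}` for distinct `i, j`, with `∞` encoded as `0`. -/
def CoxeterMatrix.IsRightAngled {I : Type*} (M : CoxeterMatrix I) : Prop :=
  ∀ i j : I, i ≠ j → M i j = 2 ∨ M i j = 0

/-- The diagram of a right-angled `M`: the vertices `i`, `j` are joined when `m_{ij} = ∞`,
with `∞` encoded as `0`. -/
def CoxeterMatrix.diagram {I : Type*} (M : CoxeterMatrix I) : SimpleGraph I where
  Adj := fun i j => M i j = 0
  symm := ⟨fun i j h => (M.symmetric j i).trans h⟩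
  loopless := ⟨fun i h => by simp at h⟩

/-- For a subgroup `H` of a group acting on `Y`, the subgroup `H⁺` generated by all the
stabilisers in `H` of points of `Y`. -/
def plusSubgroup {G : Type*} [Group G] (Y : Type*) [MulAction G Y] (H : Subgroup G) :
    Subgroup G :=
  ⨆ y : Y, H ⊓ MulAction.stabilizer G y

/-! The chambers of a right-angled building form a universal system of coloured moves
(`exists_moveHom`): assignments compatible with recolouring extend uniquely from one chamber,
because different reduced galleries with the same ends differ only by commutations (`Trace.unique`).
This yields automorphisms with prescribed constant local actions (`exists_aut`) and group-valued
functions on chambers that serve as invariants.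

Necessity. An element of `U` fixing a chamber has all its local actions in the groups generated by
point stabilisers; prescribing an arbitrary `f ∈ F i` as local action then forces `F i` to be
generated by its point stabilisers. If `m_ij = ∞` and both `F i` and `F j` are intransitive, record
the changes of orbit of the `i`- and `j`-colours by two reflections generating an infinite dihedral
group. This record is constant on `U⁺`-orbits, yet takes different values at two chambers of equal
colours, which some element of `U` with trivial local actions exchanges or maps one to the other. So
the types with transitive local group form a vertex cover.

Sufficiency. Off the cover all types commute. Modulo `U⁺`, transitive colours can be changed at
will, so any chamber `d` can be brought to the chamber obtained from a fixed `c` by recolouring the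
uncovered types as in `d` (`plusRel_moves`). For `d = g c` with `g ∈ U` those colours are related to
the colours of `c` by the local groups, so `g c` lies in the `U⁺`-orbit of `c`; as `U⁺` contains the
stabiliser of `c` in `U`, it contains `g`. -/

namespace CoxeterSystem

/-! ### Right-angled Coxeter groups: the exchange condition and pairs of descents. -/

variable {B W : Type*} [Group W] {M : CoxeterMatrix B} (cs : CoxeterSystem M W)

theorem commute_simple {i j : B} (h : M i j = 2) : Commute (cs.simple i) (cs.simple j) := by
  have h2 := cs.simple_mul_simple_pow i j
  rw [h, pow_two] at h2
  have h3 := eq_inv_of_mul_eq_one_left h2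
  rwa [mul_inv_rev, inv_simple, inv_simple] at h3

/-- If `M` is right-angled, a family of involutions lifts to the Coxeter group as soon as it
commutes whenever the simple reflections do. -/
theorem isLiftable_of_isRightAngled (hM : M.IsRightAngled) {G : Type*} [Group G] (f : B → G)
    (hf : ∀ i, f i * f i = 1) (hc : ∀ i j, M i j = 2 → Commute (f i) (f j)) :
    M.IsLiftable f := by
  intro i j
  rcases eq_or_ne i j with rfl | hij
  · rw [M.diagonal, pow_one, hf]
  · rcases hM i j hij with h | h
    · rw [h, (hc i j h).mul_pow, pow_two, pow_two, hf, hf, one_mul]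
    · rw [h, pow_zero]

theorem simple_ne_simple (hM : M.IsRightAngled) {i j : B} (hij : i ≠ j) :
    cs.simple i ≠ cs.simple j := by
  classical
  intro h
  let f : B → ℤˣ := fun k => if k = i then -1 else 1
  have hf : M.IsLiftable f := isLiftable_of_isRightAngled hM f
    (fun k => by simp only [f]; split_ifs <;> simp) (fun _ _ _ => Commute.all _ _)
  have h2 := congrArg (cs.lift ⟨f, hf⟩) h
  rw [cs.lift_apply_simple hf, cs.lift_apply_simple hf] at h2
  simp [f, hij.symm] at h2

theorem simple_mul_simple_pow_ne_one (hM : M.IsRightAngled) {i j : B} (h0 : M i j = 0) (m : ℕ) :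
    (cs.simple i * cs.simple j) ^ (m + 1) ≠ 1 := by
  classical
  have hij : i ≠ j := by rintro rfl; simp at h0
  intro h
  let f : B → DihedralGroup 0 := fun k =>
    if k = i then .sr 0 else if k = j then .sr 1 else 1
  have hf : M.IsLiftable f := by
    refine isLiftable_of_isRightAngled hM f (fun k => ?_) (fun k l hkl => ?_)
    · simp only [f]; split_ifs <;> simp only [DihedralGroup.sr_mul_self, mul_one]
    · simp only [f]
      have h0' : M j i = 0 := (M.symmetric j i).trans h0
      split_ifs <;> subst_vars <;> simp_all
  have h2 := congrArg (cs.lift ⟨f, hf⟩) h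
  rw [map_pow, map_mul, cs.lift_apply_simple hf, cs.lift_apply_simple hf, map_one] at h2
  simp only [f, if_true, hij.symm, if_false, DihedralGroup.sr_mul_sr, sub_zero,
    DihedralGroup.r_one_pow, DihedralGroup.one_def, DihedralGroup.r.injEq] at h2
  have h3 : ((m + 1 : ℕ) : ℤ) = 0 := h2
  omega

open Classical in
/-- The permutation of `W × ZMod 2` that conjugates the first coordinate by a simple reflection and
changes the second one precisely at that reflection. -/
noncomputable def signedConj (i : B) : Equiv.Perm (W × ZMod 2) :=
  Function.Involutive.toPerm
    (fun p => (cs.simple i * p.1 * cs.simple i, p.2 + if p.1 = cs.simple i then 1 else 0))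
    (by
      rintro ⟨t, e⟩
      have h : cs.simple i * t * cs.simple i = cs.simple i ↔ t = cs.simple i := by
        constructor
        · intro h
          have := congrArg (fun u => cs.simple i * u * cs.simple i) h
          simpa [mul_assoc] using this
        · rintro rfl; simp
      simp only [h, Prod.mk.injEq]
      refine ⟨by simp [mul_assoc], ?_⟩
      rw [add_assoc]
      split_ifs
      · rw [CharTwo.add_self_eq_zero, add_zero]
      · simp)

open Classical in
theorem signedConj_apply (i : B) (t : W) (e : ZMod 2) :
    cs.signedConj i (t, e) =
      (cs.simple i * t * cs.simple i, e + if t = cs.simple i then 1 else 0) := rfl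

theorem isLiftable_signedConj (hM : M.IsRightAngled) : M.IsLiftable cs.signedConj := by
  classical
  refine isLiftable_of_isRightAngled hM _ (fun i => ?_) (fun i j hij => ?_)
  · ext1 p
    exact (Function.Involutive.toPerm_involutive _) p
  -- Conjugation by a commuting reflection does not affect whether `t` is the other reflection, so
  -- the two sign changes are independent.
  · have key : ∀ a b : B, Commute (cs.simple a) (cs.simple b) → ∀ t : W,
        cs.simple b * t * cs.simple b = cs.simple a ↔ t = cs.simple a := by
      intro a b hab t
      have hb : cs.simple b * cs.simple a * cs.simple b = cs.simple a := by
        rw [← hab.eq, mul_assoc]; simp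
      constructor
      · intro h
        have := congrArg (fun u => cs.simple b * u * cs.simple b) h
        simp only [hb] at this
        simpa [mul_assoc] using this
      · rintro rfl; exact hb
    have hc := cs.commute_simple hij
    ext1 ⟨t, e⟩
    simp only [Equiv.Perm.mul_apply, signedConj_apply, key _ _ hc, key _ _ hc.symm, Prod.mk.injEq]
    refine ⟨?_, by abel⟩
    simp only [mul_assoc]
    rw [← hc.eq, ← mul_assoc, hc.eq]
    simp only [mul_assoc]

-- The left side depends only on the group element, so the parity of the number of occurrences of
-- `t` in the inversion sequence is the same for all words representing it.
open Classical in
theorem lift_signedConj_wordProd (hM : M.IsRightAngled) (ω : List B) (t : W) (e : ZMod 2) :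
    cs.lift ⟨cs.signedConj, cs.isLiftable_signedConj hM⟩ (cs.wordProd ω) (t, e) =
      (cs.wordProd ω * t * (cs.wordProd ω)⁻¹, e + ((cs.rightInvSeq ω).count t : ZMod 2)) := by
  induction ω generalizing t e with
  | nil => simp
  | cons i ω ih =>
    rw [wordProd_cons, map_mul, Equiv.Perm.mul_apply, ih, cs.lift_apply_simple, signedConj_apply]
    simp only [rightInvSeq, List.count_cons, Prod.mk.injEq, mul_inv_rev, inv_simple]
    refine ⟨by simp only [mul_assoc], ?_⟩
    have h : cs.wordProd ω * t * (cs.wordProd ω)⁻¹ = cs.simple i ↔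
        (cs.wordProd ω)⁻¹ * cs.simple i * cs.wordProd ω = t := by
      rw [mul_inv_eq_iff_eq_mul, mul_assoc, inv_mul_eq_iff_eq_mul]
      exact eq_comm
    simp only [h, beq_iff_eq]
    split_ifs <;> push_cast <;> ring

/-- The exchange condition. -/
theorem simple_mem_rightInvSeq (hM : M.IsRightAngled) {ω : List B} {j : B}
    (hj : cs.IsRightDescent (cs.wordProd ω) j) : cs.simple j ∈ cs.rightInvSeq ω := by
  classical
  obtain ⟨ω', hω', hw⟩ := cs.exists_isReduced (cs.wordProd ω * cs.simple j)
  have hw' : cs.wordProd ω = cs.wordProd (ω'.concat j) := by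
    rw [wordProd_concat, ← hw, simple_mul_simple_cancel_right]
  have hnot : cs.simple j ∉ cs.rightInvSeq ω' := fun hmem => by
    have h := (cs.isRightInversion_of_mem_rightInvSeq hω' hmem).2
    rw [← hw, simple_mul_simple_cancel_right] at h
    exact absurd hj (not_lt_of_gt h)
  -- Compare parities for `ω` and `ω' j`: in the latter, the reflection of `j` occurs exactly once,
  -- as the last entry.
  have h1 := cs.lift_signedConj_wordProd hM ω (cs.simple j) 0
  rw [hw', cs.lift_signedConj_wordProd hM, rightInvSeq_concat] at h1
  have h2 := (Prod.ext_iff.1 h1).2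
  have h3 : (List.map (MulAut.conj (cs.simple j)) (cs.rightInvSeq ω')).count (cs.simple j) = 0 := by
    rw [List.count_eq_zero, List.mem_map]
    rintro ⟨t, ht, h⟩
    have : t = cs.simple j := by
      rw [MulAut.conj_apply, inv_simple, mul_eq_right] at h
      rw [eq_inv_of_mul_eq_one_right h, inv_simple]
    exact hnot (this ▸ ht)
  simp only [List.concat_eq_append, List.count_append, h3] at h2
  by_contra hmem
  rw [List.count_eq_zero.2 hmem] at h2
  simp at h2

theorem eq_of_mem_rightInvSeq_alternatingWord (i j : B) (k : ℕ) {t : W}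
    (ht : t ∈ cs.rightInvSeq (alternatingWord i j k)) :
    ∃ m : ℕ, t = (cs.simple j * cs.simple i) ^ m * cs.simple j := by
  induction k generalizing i j t with
  | zero => simp [alternatingWord] at ht
  | succ k ih =>
    rw [alternatingWord_succ, rightInvSeq_concat, List.concat_eq_append, List.mem_append] at ht
    rcases ht with ht | ht
    · obtain ⟨u, hu, rfl⟩ := List.mem_map.1 ht
      obtain ⟨m, rfl⟩ := ih j i hu
      refine ⟨m + 1, ?_⟩
      rw [MulAut.conj_apply, inv_simple, pow_succ, ← mul_assoc, ← mul_assoc, mul_assoc,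
        ← mul_pow_mul]
      simp only [mul_assoc]
    · exact ⟨0, by simpa using ht⟩

/-- The tail grows one letter at a time by exchange, `i` and `j` swapping roles. The deleted letter
cannot lie in the tail, as `s_i s_j` has infinite order. Tails longer than `w` then rule out two
descents with `m_ij = ∞`. -/
theorem exists_isReduced_append_alternatingWord (hM : M.IsRightAngled) {i j : B} (h0 : M i j = 0)
    {w : W} (hi : cs.IsRightDescent w i) (hj : cs.IsRightDescent w j) (k : ℕ) :
    ∃ ν : List B, cs.IsReduced (ν ++ alternatingWord i j k) ∧
      w = cs.wordProd (ν ++ alternatingWord i j k) := by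
  induction k generalizing i j with
  | zero =>
    obtain ⟨ω, hω, rfl⟩ := cs.exists_isReduced w
    exact ⟨ω, by simpa [alternatingWord] using hω, by simp [alternatingWord]⟩
  | succ k ih =>
    have h0' : M j i = 0 := (M.symmetric j i).trans h0
    obtain ⟨ν, hν, rfl⟩ := ih h0' hj hi
    obtain ⟨p, hp, hpt⟩ := List.mem_iff_getElem.1 (cs.simple_mem_rightInvSeq hM hj)
    have hp' := hp
    rw [length_rightInvSeq, List.length_append] at hp'
    rcases lt_or_ge p ν.length with hlt | hge
    · have he := cs.wordProd_mul_getD_rightInvSeq (ν ++ alternatingWord j i k) p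
      rw [List.getD_eq_getElem _ _ hp, hpt, List.eraseIdx_append_of_lt_length hlt] at he
      have hw : cs.wordProd (ν ++ alternatingWord j i k) =
          cs.wordProd (ν.eraseIdx p ++ alternatingWord i j (k + 1)) := by
        rw [alternatingWord_succ, List.concat_eq_append, ← List.append_assoc,
          ← List.concat_eq_append, wordProd_concat, ← he, simple_mul_simple_cancel_right]
      refine ⟨ν.eraseIdx p, ?_, hw⟩
      have hl := List.length_eraseIdx_add_one hlt
      have h1 : cs.length (cs.wordProd (ν ++ alternatingWord j i k)) = _ := hν
      rw [IsReduced, ← hw, h1, List.length_append, List.length_append, length_alternatingWord,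
        length_alternatingWord]
      omega
    · exfalso
      have hmem : cs.simple j ∈ cs.rightInvSeq (alternatingWord j i k) := by
        have hd := cs.rightInvSeq_drop (ν ++ alternatingWord j i k) ν.length
        rw [List.drop_left] at hd
        rw [hd, ← hpt]
        exact List.mem_drop_iff_getElem.2 ⟨p - ν.length, by omega, by congr 1; omega⟩
      obtain ⟨m, hm⟩ := cs.eq_of_mem_rightInvSeq_alternatingWord j i k hmem
      refine cs.simple_mul_simple_pow_ne_one hM h0 m ?_
      rw [pow_succ, ← mul_assoc, ← hm, simple_mul_simple_self]

theorem eq_two_of_isRightDescent (hM : M.IsRightAngled) {i j : B} (hij : i ≠ j)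
    {w : W} (hi : cs.IsRightDescent w i) (hj : cs.IsRightDescent w j) : M i j = 2 := by
  refine (hM i j hij).resolve_right fun h0 => ?_
  obtain ⟨ν, hν, hw⟩ := cs.exists_isReduced_append_alternatingWord hM h0 hi hj (cs.length w + 1)
  have h : cs.length (cs.wordProd _) = _ := hν
  rw [← hw, List.length_append, length_alternatingWord] at h
  omega

/-- An element with two distinct right descents `i`, `j` has reduced words ending in both orders
of `i` and `j`. -/
theorem exists_isReduced_of_isRightDescent (hM : M.IsRightAngled) {i j : B} (hij : i ≠ j)
    {w : W} (hi : cs.IsRightDescent w i) (hj : cs.IsRightDescent w j) :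
    ∃ μ : List B, w = cs.wordProd (μ ++ [i] ++ [j]) ∧ cs.IsReduced (μ ++ [i] ++ [j]) := by
  obtain ⟨ν, hν, hw⟩ := cs.exists_isReduced (w * cs.simple i)
  have hw' : w = cs.wordProd (ν ++ [i]) := by
    rw [wordProd_append, wordProd_singleton, ← hw, simple_mul_simple_cancel_right]
  have hl : cs.length w = ν.length + 1 := by
    have h1 := cs.isRightDescent_iff.1 hi
    rw [hw, hν.eq] at h1
    exact h1.symm
  have hj' := hj
  rw [hw'] at hj'
  obtain ⟨p, hp, hpt⟩ := List.mem_iff_getElem.1 (cs.simple_mem_rightInvSeq hM hj')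
  have he := cs.wordProd_mul_getD_rightInvSeq (ν ++ [i]) p
  rw [List.getD_eq_getElem _ _ hp, hpt] at he
  have hp' := hp
  rw [length_rightInvSeq, List.length_append, List.length_singleton] at hp'
  rcases lt_or_ge p ν.length with hlt | hge
  · rw [List.eraseIdx_append_of_lt_length hlt, ← hw'] at he
    have hw2 : w = cs.wordProd (ν.eraseIdx p ++ [i] ++ [j]) := by
      rw [wordProd_append, wordProd_singleton, ← he, simple_mul_simple_cancel_right]
    refine ⟨_, hw2, ?_⟩
    have h1 := List.length_eraseIdx_add_one hlt
    rw [IsReduced, ← hw2, hl]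
    simp only [List.length_append, List.length_singleton]
    omega
  · exfalso
    have : p = ν.length := by omega
    subst this
    rw [List.eraseIdx_append_of_length_le le_rfl, ← hw'] at he
    simp only [Nat.sub_self, List.eraseIdx_zero, List.tail_cons, List.append_nil] at he
    rw [← hw] at he
    exact cs.simple_ne_simple hM hij (mul_left_cancel he).symm

theorem isReduced_append_singleton_of_not_isRightDescent {ω : List B} {i : B}
    (hω : cs.IsReduced ω) (h : ¬ cs.IsRightDescent (cs.wordProd ω) i) :
    cs.IsReduced (ω ++ [i]) := by
  rw [cs.not_isRightDescent_iff, hω.eq] at h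
  rw [IsReduced, wordProd_append, wordProd_singleton, h]
  simp

theorem IsReduced.of_append {cs : CoxeterSystem M W} {ω ω' : List B}
    (h : cs.IsReduced (ω ++ ω')) : cs.IsReduced ω := by
  simpa using h.take ω.length

theorem IsReduced.isRightDescent {cs : CoxeterSystem M W} {ω : List B} {i : B}
    (h : cs.IsReduced (ω ++ [i])) : cs.IsRightDescent (cs.wordProd (ω ++ [i])) i := by
  have h1 := h.of_append.eq
  have h2 := h.eq
  rw [IsRightDescent, h2, wordProd_append, wordProd_singleton, simple_mul_simple_cancel_right, h1]
  simp

end CoxeterSystem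

/-! ### Coloured systems of moves. -/

/-- A coloured system of moves of type `M`: the move `act s i x` changes the `i`-colour of `s` to
`x`, and moves of commuting types commute. -/
structure MoveSystem {I : Type*} (M : CoxeterMatrix I) (X : I → Type*) (S : Type*) where
  col : S → ∀ i, X i
  act : S → ∀ i, X i → S
  col_act_self : ∀ s i x, col (act s i x) i = x
  col_act_of_ne : ∀ s i x j, j ≠ i → col (act s i x) j = col s j
  act_col : ∀ s i, act s i (col s i) = s
  act_act : ∀ s i x y, act (act s i x) i y = act s i y
  act_comm : ∀ i j, M i j = 2 → ∀ s x y, act (act s i x) j y = act (act s j y) i x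

namespace MoveSystem

variable {I : Type*} {M : CoxeterMatrix I} {X : I → Type*} {S : Type*}

/-- Relabel the colours of a system of moves. -/
def twist (A : MoveSystem M X S) (f : ∀ i, Equiv.Perm (X i)) : MoveSystem M X S where
  col s i := (f i).symm (A.col s i)
  act s i x := A.act s i (f i x)
  col_act_self s i x := by rw [A.col_act_self, Equiv.symm_apply_apply]
  col_act_of_ne s i x j h := by rw [A.col_act_of_ne _ _ _ _ h]
  act_col s i := by rw [Equiv.apply_symm_apply, A.act_col]
  act_act s i x y := A.act_act _ _ _ _
  act_comm i j h s x y := A.act_comm i j h _ _ _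

open Classical in
/-- The system of moves in which an `i`-move from colour `x` to colour `y` contributes the factor
`(φ i x)⁻¹ * φ i y` to an element of a group. -/
noncomputable def ofGroup {G : Type*} [Group G] (φ : ∀ i, X i → G)
    (hφ : ∀ i j, M i j = 2 → ∀ x y, Commute (φ i x) (φ j y)) :
    MoveSystem M X (G × ∀ i, X i) where
  col s := s.2
  act s i x := (s.1 * ((φ i (s.2 i))⁻¹ * φ i x), Function.update s.2 i x)
  col_act_self s i x := by simp
  col_act_of_ne s i x j h := by simp [h]
  act_col s i := by simp
  act_act s i x y := by simp [mul_assoc]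
  act_comm i j h s x y := by
    have hij : i ≠ j := by rintro rfl; simp at h
    have hc : Commute ((φ i (s.2 i))⁻¹ * φ i x) ((φ j (s.2 j))⁻¹ * φ j y) :=
      ((hφ i j h _ _).inv_inv.mul_left (hφ i j h _ _).inv_right).mul_right
        ((hφ i j h _ _).inv_left.mul_left (hφ i j h _ _))
    simp only [Prod.mk.injEq, Function.update_of_ne hij, Function.update_of_ne hij.symm, mul_assoc]
    refine ⟨?_, Function.update_comm hij _ _ _⟩
    have := hc.eq
    simp only [mul_assoc] at this
    rw [this]

end MoveSystem

/-! ### Galleries and moves between chambers. -/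

namespace ChamberSystem

variable {I C : Type*} {D : ChamberSystem I C} {M : CoxeterMatrix I} {X : I → Type*}

theorem Gallery.snoc {ω : List I} {x y z : C} {i : I} (h : D.Gallery ω x y)
    (hz : (D.adj i).r y z) (hne : y ≠ z) : D.Gallery (ω ++ [i]) x z := by
  induction ω generalizing x with
  | nil => cases h; exact ⟨z, hz, hne, rfl⟩
  | cons j ω ih =>
    obtain ⟨u, hu, hu', h⟩ := h
    exact ⟨u, hu, hu', ih h⟩

theorem Gallery.exists_of_snoc {ω : List I} {x z : C} {i : I} (h : D.Gallery (ω ++ [i]) x z) :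
    ∃ y, D.Gallery ω x y ∧ (D.adj i).r y z ∧ y ≠ z := by
  induction ω generalizing x with
  | nil =>
    obtain ⟨u, hu, hu', h⟩ := h
    cases h
    exact ⟨x, rfl, hu, hu'⟩
  | cons j ω ih =>
    obtain ⟨u, hu, hu', h⟩ := h
    obtain ⟨y, hy, h2⟩ := ih h
    exact ⟨y, ⟨u, hu, hu', hy⟩, h2⟩

namespace LegalColouring

variable (L : D.LegalColouring X)

/-- The chamber of `i`-colour `x` in the `i`-panel of `c`. -/
noncomputable def move (c : C) (i : I) (x : X i) : C := ((L.panelColour i c).symm x).1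

theorem adj_move (c : C) (i : I) (x : X i) : (D.adj i).r c (L.move c i x) :=
  ((L.panelColour i c).symm x).2

theorem col_move_self (c : C) (i : I) (x : X i) : L.col (L.move c i x) i = x :=
  (L.panelColour i c).apply_symm_apply x

theorem col_move_of_ne (c : C) (i : I) (x : X i) {j : I} (h : j ≠ i) :
    L.col (L.move c i x) j = L.col c j :=
  L.constant i j h c _ (L.adj_move c i x)

theorem move_eq {c d : C} {i : I} (h : (D.adj i).r c d) : L.move c i (L.col d i) = d := by
  have h2 : (L.panelColour i c).symm (L.col d i) = ⟨d, h⟩ := by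
    rw [Equiv.symm_apply_eq]; rfl
  exact congrArg Subtype.val h2

theorem move_col (c : C) (i : I) : L.move c i (L.col c i) = c :=
  L.move_eq ((D.adj i).refl' c)

theorem move_of_adj {c d : C} {i : I} (h : (D.adj i).r c d) (x : X i) :
    L.move d i x = L.move c i x := by
  have h2 := L.move_eq ((D.adj i).trans' h (L.adj_move d i x))
  rw [← h2, col_move_self]

theorem move_move (c : C) (i : I) (x y : X i) : L.move (L.move c i x) i y = L.move c i y :=
  L.move_of_adj (L.adj_move c i x) y

theorem ne_move_iff {c : C} {i : I} {x : X i} : c ≠ L.move c i x ↔ x ≠ L.col c i := by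
  refine not_congr ⟨fun h => ?_, fun h => ?_⟩
  · rw [h, col_move_self]
  · rw [h, move_col]

theorem move_comm (hM : M.IsRightAngled) (hD : D.IsBuilding M) {i j : I} (hij : M i j = 2)
    (c : C) (x : X i) (y : X j) :
    L.move (L.move c i x) j y = L.move (L.move c j y) i x := by
  have hne : i ≠ j := by rintro rfl; simp at hij
  by_cases hx : x = L.col c i
  · subst hx
    rw [move_col, ← L.col_move_of_ne c j y hne, move_col]
  by_cases hy : y = L.col c j
  · subst hy
    rw [move_col, ← L.col_move_of_ne c i x hne.symm, move_col]
  obtain ⟨δ, hδ⟩ := hD.exists_dist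
  set cs := M.toCoxeterSystem
  have hred : ∀ i j : I, i ≠ j → cs.IsReduced [i, j] := fun i j hij => by
    refine cs.isReduced_append_singleton_of_not_isRightDescent (ω := [i]) (i := j) ?_ ?_
    · rw [CoxeterSystem.IsReduced, cs.wordProd_singleton, cs.length_simple]; rfl
    · rw [cs.wordProd_singleton, CoxeterSystem.IsRightDescent, cs.length_simple, Nat.lt_one_iff,
        cs.length_eq_zero_iff]
      intro h
      apply cs.simple_ne_simple hM hij
      rw [eq_inv_of_mul_eq_one_left h, cs.inv_simple]
  have h1 : D.Gallery [i, j] c (L.move (L.move c i x) j y) :=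
    ⟨_, L.adj_move _ _ _, L.ne_move_iff.2 hx, _, L.adj_move _ _ _,
      L.ne_move_iff.2 (by rwa [L.col_move_of_ne _ _ _ hne.symm]), rfl⟩
  -- The words `ij` and `ji` are reduced and represent the same element, so a gallery of type `ji`
  -- has the same ends; the colours identify its chambers.
  rw [← hδ _ (hred i j hne), cs.wordProd_cons, cs.wordProd_singleton, (cs.commute_simple hij).eq,
    ← cs.wordProd_singleton i, ← cs.wordProd_cons, hδ _ (hred j i hne.symm)] at h1
  obtain ⟨u, hu, -, v, hv, -, rfl⟩ := h1
  have hu' := L.move_eq hu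
  have hv' := L.move_eq hv
  rw [L.col_move_of_ne _ _ _ hne, col_move_self] at hv'
  have h3 := L.constant i j hne.symm u _ hv
  rw [col_move_self] at h3
  rw [← hv', ← hu', ← h3]

/-- The system of moves on the chambers of a right-angled building. -/
noncomputable def moveSystem (hM : M.IsRightAngled) (hD : D.IsBuilding M) :
    MoveSystem M X C where
  col := L.col
  act := L.move
  col_act_self := L.col_move_self
  col_act_of_ne c i x _ h := L.col_move_of_ne c i x h
  act_col := L.move_col
  act_act := L.move_move
  act_comm _ _ h := L.move_comm hM hD h

/-! ### Transporting moves along reduced galleries. -/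

/-- `L.Trace A c₀ s₀ ω c s`: a gallery of type `ω` leads from `c₀` to `c`, and the corresponding
sequence of moves in `A` leads from `s₀` to `s`. -/
inductive Trace {S : Type*} (A : MoveSystem M X S) (c₀ : C) (s₀ : S) : List I → C → S → Prop
  | nil : Trace A c₀ s₀ [] c₀ s₀
  | snoc {ω : List I} {c : C} {s : S} (i : I) (x : X i) : Trace A c₀ s₀ ω c s → x ≠ L.col c i →
      Trace A c₀ s₀ (ω ++ [i]) (L.move c i x) (A.act s i x)

variable {L} {S : Type*} {A : MoveSystem M X S} {c₀ : C} {s₀ : S}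

theorem Trace.gallery {ω : List I} {c : C} {s : S} (h : L.Trace A c₀ s₀ ω c s) :
    D.Gallery ω c₀ c := by
  induction h with
  | nil => rfl
  | snoc i x _ hx ih => exact ih.snoc (L.adj_move _ _ _) (L.ne_move_iff.2 hx)

theorem Trace.col_eq (h₀ : A.col s₀ = L.col c₀) {ω : List I} {c : C} {s : S}
    (h : L.Trace A c₀ s₀ ω c s) : A.col s = L.col c := by
  induction h with
  | nil => exact h₀
  | @snoc ω c s i x _ hx ih =>
    funext j
    rcases eq_or_ne j i with rfl | hj
    · rw [A.col_act_self, L.col_move_self]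
    · rw [A.col_act_of_ne _ _ _ _ hj, L.col_move_of_ne _ _ _ hj, ih]

theorem Trace.of_nil {c : C} {s : S} (h : L.Trace A c₀ s₀ [] c s) : c = c₀ ∧ s = s₀ := by
  generalize hω : ([] : List I) = ω at h
  cases h with
  | nil => exact ⟨rfl, rfl⟩
  | snoc => simp at hω

theorem Trace.of_snoc {ω : List I} {i : I} {c : C} {s : S}
    (h : L.Trace A c₀ s₀ (ω ++ [i]) c s) :
    ∃ d t, L.Trace A c₀ s₀ ω d t ∧ L.col c i ≠ L.col d i ∧ c = L.move d i (L.col c i) ∧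
      s = A.act t i (L.col c i) := by
  generalize hω : ω ++ [i] = ω' at h
  cases h with
  | nil => simp at hω
  | snoc j x h hx =>
    obtain ⟨rfl, h2⟩ := List.append_inj' hω rfl
    obtain rfl : i = j := by simpa using h2
    exact ⟨_, _, h, by rwa [L.col_move_self], by rw [L.col_move_self], by rw [L.col_move_self]⟩

theorem exists_trace_of_gallery (A : MoveSystem M X S) (s₀ : S) {ω : List I} {c : C}
    (h : D.Gallery ω c₀ c) : ∃ s, L.Trace A c₀ s₀ ω c s := by
  induction ω using List.reverseRecOn generalizing c with
  | nil => cases h; exact ⟨_, .nil⟩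
  | append_singleton ω i ih =>
    obtain ⟨d, hd, hdc, hne⟩ := h.exists_of_snoc
    obtain ⟨s, hs⟩ := ih hd
    have h2 := L.move_eq hdc
    refine ⟨A.act s i (L.col c i), ?_⟩
    have h3 := hs.snoc i (L.col c i) (by rw [← L.ne_move_iff, h2]; exact hne)
    rwa [h2] at h3

/-- Induction on length. With equal last letters, both galleries have the same penultimate chamber.
With last letters `i ≠ j`, both are descents, so `m_ij = 2`, and both traces are compared with one
along a word ending in `ij`, whose last two moves may be swapped. -/
theorem Trace.unique (hM : M.IsRightAngled) (hD : D.IsBuilding M) (n : ℕ) {ω ω' : List I}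
    (hn : ω.length = n) (hn' : ω'.length = n) (hω : M.toCoxeterSystem.IsReduced ω)
    (hω' : M.toCoxeterSystem.IsReduced ω') {c : C} {s s' : S} (h : L.Trace A c₀ s₀ ω c s)
    (h' : L.Trace A c₀ s₀ ω' c s') : s = s' := by
  obtain ⟨δ, hδ⟩ := hD.exists_dist
  induction n generalizing ω ω' c s s' with
  | zero =>
    obtain rfl := List.length_eq_zero_iff.1 hn
    obtain rfl := List.length_eq_zero_iff.1 hn'
    exact h.of_nil.2.trans h'.of_nil.2.symm
  | succ n ih =>
    set cs := M.toCoxeterSystem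
    have same : ∀ {ν ν' : List I} {i : I} {c : C} {s s' : S}, ν.length = n → ν'.length = n →
        cs.IsReduced (ν ++ [i]) → cs.IsReduced (ν' ++ [i]) → L.Trace A c₀ s₀ (ν ++ [i]) c s →
        L.Trace A c₀ s₀ (ν' ++ [i]) c s' → s = s' := by
      intro ν ν' i c s s' hν hν' hr hr' h h'
      have e1 := (hδ _ hr _ _).2 h.gallery
      rw [(hδ _ hr' _ _).2 h'.gallery, cs.wordProd_append, cs.wordProd_append] at e1
      have e2 := mul_right_cancel e1
      obtain ⟨d, t, ht, hne, hc, rfl⟩ := h.of_snoc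
      obtain ⟨d', t', ht', hne', hc', rfl⟩ := h'.of_snoc
      -- Otherwise `d` and `d'` are distinct in one `i`-panel, and the distance from `c₀` to `d'` is
      -- given both by `ν` and by `ν i`, forcing `s_i = 1`.
      have hdd : d = d' := by
        by_contra hdd
        have hd := L.adj_move d i (L.col c i)
        have hd' := L.adj_move d' i (L.col c i)
        rw [← hc] at hd
        rw [← hc'] at hd'
        have ha : (D.adj i).r d d' := (D.adj i).trans' hd ((D.adj i).symm' hd')
        have g := ht.gallery.snoc ha hdd
        rw [← hδ _ hr, (hδ _ hr'.of_append _ _).2 ht'.gallery, e2, cs.wordProd_append,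
          left_eq_mul, cs.wordProd_singleton] at g
        have := cs.length_simple i
        rw [g, cs.length_one] at this
        omega
      subst hdd
      rw [ih hν hν' hr.of_append hr'.of_append ht ht']
    rcases List.eq_nil_or_concat ω with rfl | ⟨ν, i, rfl⟩
    · simp at hn
    rcases List.eq_nil_or_concat ω' with rfl | ⟨ν', j, rfl⟩
    · simp at hn'
    rw [List.concat_eq_append] at *
    have hν : ν.length = n := by simpa using hn
    have hν' : ν'.length = n := by simpa using hn'
    rcases eq_or_ne i j with rfl | hij
    · exact same hν hν' hω hω' h h'
    have e1 := (hδ _ hω _ _).2 h.gallery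
    have e2 := (hδ _ hω' _ _).2 h'.gallery
    have hi : cs.IsRightDescent (δ c₀ c) i := by rw [e1]; exact hω.isRightDescent
    have hj : cs.IsRightDescent (δ c₀ c) j := by rw [e2]; exact hω'.isRightDescent
    have h2 := cs.eq_two_of_isRightDescent hM hij hi hj
    obtain ⟨μ, hμ, hμr⟩ := cs.exists_isReduced_of_isRightDescent hM hij hi hj
    have hcomm : cs.wordProd (μ ++ [j] ++ [i]) = cs.wordProd (μ ++ [i] ++ [j]) := by
      simp only [cs.wordProd_append, cs.wordProd_singleton, mul_assoc, (cs.commute_simple h2).eq]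
    have hμr' : cs.IsReduced (μ ++ [j] ++ [i]) := by
      rw [CoxeterSystem.IsReduced, hcomm, hμr.eq]; simp
    have hlen : μ.length + 1 = n := by
      have h1 := hω.eq
      rw [← e1, hμ, hμr.eq] at h1
      simp only [List.length_append, List.length_singleton] at h1
      omega
    have g := (hδ _ hμr _ _).1 hμ
    obtain ⟨s₁, hs₁⟩ := exists_trace_of_gallery (L := L) A s₀ g
    have hs₂ : L.Trace A c₀ s₀ (μ ++ [j] ++ [i]) c s₁ := by
      obtain ⟨d, t, ht, hne, hc, rfl⟩ := hs₁.of_snoc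
      obtain ⟨e, u, hu, hne', hd, rfl⟩ := ht.of_snoc
      generalize L.col d i = x at *
      generalize L.col c j = y at *
      subst hd
      rw [L.col_move_of_ne _ _ _ hij.symm] at hne
      rw [A.act_comm i j h2, hc, L.move_comm hM hD h2]
      exact (hu.snoc j y hne).snoc i x (by rwa [L.col_move_of_ne _ _ _ hij])
    rw [same hν (by simpa using hlen) hω hμr' h hs₂, same hν' (by simpa using hlen) hω' hμr h' hs₁]

/-- If `i` is not a descent, the move lengthens the reduced word. If it is, `Trace.unique` allows a
reduced gallery whose last step is already an `i`-move, which the new move overwrites or undoes. -/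
theorem Trace.exists_move (hM : M.IsRightAngled) (hD : D.IsBuilding M)
    (h₀ : A.col s₀ = L.col c₀) {ω : List I} (hω : M.toCoxeterSystem.IsReduced ω)
    {c : C} {s : S} (h : L.Trace A c₀ s₀ ω c s) (i : I) (x : X i) :
    ∃ ω', M.toCoxeterSystem.IsReduced ω' ∧ L.Trace A c₀ s₀ ω' (L.move c i x) (A.act s i x) := by
  obtain ⟨δ, hδ⟩ := hD.exists_dist
  set cs := M.toCoxeterSystem
  by_cases hx : x = L.col c i
  · refine ⟨ω, hω, ?_⟩
    rw [hx, L.move_col, ← h.col_eq h₀, A.act_col]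
    exact h
  by_cases hi : cs.IsRightDescent (cs.wordProd ω) i
  · obtain ⟨ν, hν, hw⟩ := cs.exists_isReduced (cs.wordProd ω * cs.simple i)
    have hw' : cs.wordProd ω = cs.wordProd (ν ++ [i]) := by
      rw [cs.wordProd_append, cs.wordProd_singleton, ← hw, cs.simple_mul_simple_cancel_right]
    have hlen : (ν ++ [i]).length = ω.length := by
      have h1 := cs.isRightDescent_iff.1 hi
      rw [hw, hν.eq, hω.eq] at h1
      simpa using h1
    have hν' : cs.IsReduced (ν ++ [i]) := by
      rw [CoxeterSystem.IsReduced, ← hw', hω.eq, hlen]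
    have e1 := (hδ _ hω _ _).2 h.gallery
    rw [hw', hδ _ hν'] at e1
    obtain ⟨s', hs'⟩ := exists_trace_of_gallery (L := L) A s₀ e1
    obtain rfl := Trace.unique hM hD _ rfl hlen hω hν' h hs'
    obtain ⟨d, t, ht, hne, hc, rfl⟩ := hs'.of_snoc
    rw [hc, L.move_move, A.act_act]
    by_cases hd : x = L.col d i
    · rw [hd, L.move_col, ← ht.col_eq h₀, A.act_col]
      exact ⟨ν, hν, ht⟩
    · exact ⟨_, hν', ht.snoc i x hd⟩
  · exact ⟨_, cs.isReduced_append_singleton_of_not_isRightDescent hω hi, h.snoc i x hx⟩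

theorem exists_reduced_trace (hD : D.IsBuilding M) (A : MoveSystem M X S) (c₀ : C) (s₀ : S)
    (c : C) : ∃ s, ∃ ω, M.toCoxeterSystem.IsReduced ω ∧ L.Trace A c₀ s₀ ω c s := by
  obtain ⟨δ, hδ⟩ := hD.exists_dist
  obtain ⟨ω, hω, hw⟩ := M.toCoxeterSystem.exists_isReduced (δ c₀ c)
  obtain ⟨s, hs⟩ := exists_trace_of_gallery (L := L) A s₀ ((hδ ω hω c₀ c).1 hw)
  exact ⟨s, ω, hω, hs⟩

/-! ### The universal property and automorphisms with prescribed local actions. -/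

variable (L)

theorem move_induction (hD : D.IsBuilding M) {p : C → Prop} (c₀ : C) (h₀ : p c₀)
    (h : ∀ c i x, p c → p (L.move c i x)) (c : C) : p c := by
  obtain ⟨δ, hδ⟩ := hD.exists_dist
  obtain ⟨ω, hω, hw⟩ := M.toCoxeterSystem.exists_isReduced (δ c₀ c)
  have g := (hδ ω hω c₀ c).1 hw
  clear hω hw
  induction ω generalizing c₀ with
  | nil => cases g; exact h₀
  | cons i ω ih =>
    obtain ⟨z, hz, -, g⟩ := g
    exact ih z (by rw [← L.move_eq hz]; exact h _ _ _ h₀) g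

/-- The chambers of a right-angled building form a universal system of moves. -/
theorem exists_moveHom (hM : M.IsRightAngled) (hD : D.IsBuilding M) (A : MoveSystem M X S)
    (c₀ : C) (s₀ : S) (h₀ : A.col s₀ = L.col c₀) :
    ∃ H : C → S, H c₀ = s₀ ∧ (∀ c i x, H (L.move c i x) = A.act (H c) i x) ∧
      ∀ c, A.col (H c) = L.col c := by
  choose H hH using exists_reduced_trace (L := L) hD A c₀ s₀
  have huniq : ∀ {c : C} {s : S} {ω : List I}, M.toCoxeterSystem.IsReduced ω →
      L.Trace A c₀ s₀ ω c s → H c = s := by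
    intro c s ω hω h
    obtain ⟨ω', hω', h'⟩ := hH c
    obtain ⟨δ, hδ⟩ := hD.exists_dist
    have hlen : ω.length = ω'.length := by
      rw [← hω.eq, ← hω'.eq, ← (hδ _ hω _ _).2 h.gallery, ← (hδ _ hω' _ _).2 h'.gallery]
    exact Trace.unique hM hD _ rfl hlen hω' hω h' h
  refine ⟨H, huniq (ω := []) (by simp [CoxeterSystem.IsReduced]) .nil, fun c i x => ?_,
    fun c => ?_⟩
  · obtain ⟨ω, hω, h⟩ := hH c
    obtain ⟨ω', hω', h'⟩ := h.exists_move hM hD h₀ hω i x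
    exact huniq hω' h'
  · obtain ⟨ω, hω, h⟩ := hH c
    exact h.col_eq h₀

/-- Automorphisms with prescribed constant local actions: given permutations `f i` of the colour
sets that map the colours of `c₀` to those of `d₀`, there is an automorphism that maps `c₀` to `d₀`
and acts on colours by `f`. -/
theorem exists_aut (hM : M.IsRightAngled) (hD : D.IsBuilding M) (f : ∀ i, Equiv.Perm (X i))
    (c₀ d₀ : C) (h : ∀ i, f i (L.col c₀ i) = L.col d₀ i) :
    ∃ g : D.Aut, g.1 c₀ = d₀ ∧ (∀ c i x, g.1 (L.move c i x) = L.move (g.1 c) i (f i x)) ∧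
      ∀ i c, L.localAction g i c = f i := by
  obtain ⟨H, H₀, Hm, Hc⟩ := L.exists_moveHom hM hD ((L.moveSystem hM hD).twist f) c₀ d₀
    (funext fun i => (f i).symm_apply_eq.2 (h i).symm)
  -- The inverse map comes from the inverse permutations with base chambers exchanged; both
  -- composites are the identity by induction along moves.
  obtain ⟨K, K₀, Km, Kc⟩ := L.exists_moveHom hM hD
    ((L.moveSystem hM hD).twist fun i => (f i).symm) d₀ c₀ (funext fun i => h i)
  replace Hm : ∀ c i x, H (L.move c i x) = L.move (H c) i (f i x) := Hm
  replace Km : ∀ c i x, K (L.move c i x) = L.move (K c) i ((f i).symm x) := Km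
  replace Hc : ∀ c i, L.col (H c) i = f i (L.col c i) := fun c i => by
    rw [← Hc c]; exact ((f i).apply_symm_apply _).symm
  have hKH : ∀ c, K (H c) = c := L.move_induction hD c₀ (by rw [H₀, K₀]) fun c i x ih => by
    rw [Hm, Km, ih, Equiv.symm_apply_apply]
  have hHK : ∀ c, H (K c) = c := L.move_induction hD d₀ (by rw [K₀, H₀]) fun c i x ih => by
    rw [Km, Hm, ih, Equiv.apply_symm_apply]
  have adjH : ∀ i x y, (D.adj i).r x y → (D.adj i).r (H x) (H y) := fun i x y hxy => by
    rw [← L.move_eq hxy, Hm]; exact L.adj_move _ _ _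
  have adjK : ∀ i x y, (D.adj i).r x y → (D.adj i).r (K x) (K y) := fun i x y hxy => by
    rw [← L.move_eq hxy, Km]; exact L.adj_move _ _ _
  refine ⟨⟨⟨H, K, hKH, hHK⟩, fun i x y => ⟨fun hxy => ?_, adjH i x y⟩⟩, H₀, Hm, fun i c => ?_⟩
  · have := adjK i _ _ hxy
    rwa [Equiv.coe_fn_mk, hKH, hKH] at this
  · ext x
    obtain ⟨d, hd, rfl⟩ := L.exists_col_eq i c x
    rw [L.localAction_col _ i c d hd]
    exact Hc d i

end LegalColouring

end ChamberSystem

/-! ### Subgroups generated by stabilisers, and successive moves of commuting types. -/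

theorem plusSubgroup_le {G : Type*} [Group G] (Y : Type*) [MulAction G Y] (H : Subgroup G) :
    plusSubgroup Y H ≤ H :=
  iSup_le fun _ => inf_le_left

theorem mem_plusSubgroup {G : Type*} [Group G] {Y : Type*} [MulAction G Y] {H : Subgroup G}
    {g : G} (hg : g ∈ H) {y : Y} (hy : g • y = y) : g ∈ plusSubgroup Y H :=
  Subgroup.mem_iSup_of_mem (S := fun y : Y => H ⊓ MulAction.stabilizer G y) y ⟨hg, hy⟩

namespace ChamberSystem

namespace LegalColouring

variable {I C : Type*} {D : ChamberSystem I C} {M : CoxeterMatrix I} {X : I → Type*}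
  (L : D.LegalColouring X)

theorem localAction_apply_col (g : D.Aut) (i : I) (c : C) :
    L.localAction g i c (L.col c i) = L.col (g.1 c) i :=
  L.localAction_col g i c c ((D.adj i).refl' c)

theorem localAction_congr (g : D.Aut) {i : I} {c d : C} (h : (D.adj i).r c d) :
    L.localAction g i d = L.localAction g i c := by
  ext x
  obtain ⟨e, he, rfl⟩ := L.exists_col_eq i d x
  rw [L.localAction_col g i d e he, L.localAction_col g i c e ((D.adj i).trans' h he)]

theorem apply_move (g : D.Aut) (c : C) (i : I) (x : X i) :
    g.1 (L.move c i x) = L.move (g.1 c) i (L.localAction g i c x) := by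
  rw [← L.move_eq ((g.2 i _ _).2 (L.adj_move c i x)),
    ← L.localAction_col g i c _ (L.adj_move c i x), col_move_self]

/-- The chamber reached from `c` by moving successively to the colours `z j`, for `j` in `l`. -/
noncomputable def moves (c : C) (l : List I) (z : ∀ i, X i) : C :=
  l.foldl (fun d j => L.move d j (z j)) c

theorem moves_cons (c : C) (j : I) (l : List I) (z : ∀ i, X i) :
    L.moves c (j :: l) z = L.moves (L.move c j (z j)) l z := rfl

theorem moves_congr (c : C) {l : List I} {z z' : ∀ i, X i} (h : ∀ j ∈ l, z j = z' j) :
    L.moves c l z = L.moves c l z' := by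
  induction l generalizing c with
  | nil => rfl
  | cons k l ih =>
    rw [moves_cons, moves_cons, h k (by simp), ih _ fun j hj => h j (by simp [hj])]

theorem moves_col (c : C) (l : List I) : L.moves c l (L.col c) = c := by
  induction l with
  | nil => rfl
  | cons k l ih => rw [moves_cons, move_col, ih]

theorem move_moves_of_notMem (hM : M.IsRightAngled) (hD : D.IsBuilding M) (c : C) {l : List I}
    {j : I} (h : ∀ k ∈ l, M k j = 2) (z : ∀ i, X i) (y : X j) :
    L.move (L.moves c l z) j y = L.moves (L.move c j y) l z := by
  induction l generalizing c with
  | nil => rfl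
  | cons k l ih =>
    rw [moves_cons, moves_cons, ih _ fun k hk => h k (by simp [hk]),
      L.move_comm hM hD (h k (by simp))]

theorem move_moves (hM : M.IsRightAngled) (hD : D.IsBuilding M) (c : C) {l : List I}
    (hl : l.Pairwise fun i j => M i j = 2) {j : I} (hj : j ∈ l) {z z' : ∀ i, X i}
    (h : ∀ k, k ≠ j → z' k = z k) :
    L.move (L.moves c l z) j (z' j) = L.moves c l z' := by
  induction l generalizing c with
  | nil => simp at hj
  | cons k l ih =>
    rw [List.pairwise_cons] at hl
    rw [moves_cons, moves_cons]
    rcases eq_or_ne j k with rfl | hjk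
    · rw [L.move_moves_of_notMem hM hD _ (fun k hk => (M.symmetric k j).trans (hl.1 k hk)),
        move_move]
      refine L.moves_congr _ fun k hk => (h k ?_).symm
      rintro rfl
      have := hl.1 _ hk
      simp at this
    · rw [ih _ hl.2 ((List.mem_cons.1 hj).resolve_left hjk), h k hjk.symm]

/-! ### Necessity of the two conditions. -/

variable (F : ∀ i, Subgroup (Equiv.Perm (X i)))

/-- The local actions of the elements of `U⁺` lie in the groups generated by point stabilisers. -/
theorem localAction_mem_plusSubgroup (hD : D.IsBuilding M) {g : D.Aut}
    (hg : g ∈ plusSubgroup C (L.universalGroup F)) (i : I) (c : C) :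
    L.localAction g i c ∈ plusSubgroup (X i) (F i) := by
  suffices h : plusSubgroup C (L.universalGroup F) ≤
      L.universalGroup fun i => plusSubgroup (X i) (F i) from h hg i c
  refine iSup_le fun c₀ g ⟨hg, hc₀⟩ i => ?_
  replace hc₀ : g.1 c₀ = c₀ := hc₀
  refine L.move_induction hD c₀ (mem_plusSubgroup (hg i c₀) (y := L.col c₀ i) ?_)
    fun c j x ih => ?_
  · rw [Equiv.Perm.smul_def, localAction_apply_col, hc₀]
  rcases eq_or_ne i j with rfl | hij
  · rwa [L.localAction_congr g (L.adj_move c i x)]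
  -- A `j`-move keeps `i`-colours, before and after applying `g`; hence both local actions agree at
  -- `L.col c i` and differ by an element of its stabiliser.
  · have h : (L.localAction g i c)⁻¹ * L.localAction g i (L.move c j x) ∈
        plusSubgroup (X i) (F i) := by
      refine mem_plusSubgroup ((F i).mul_mem ((F i).inv_mem (hg i c)) (hg i _))
        (y := L.col c i) ?_
      rw [Equiv.Perm.smul_def, Equiv.Perm.mul_apply, Equiv.Perm.inv_eq_iff_eq,
        localAction_apply_col, ← L.col_move_of_ne c j x hij, localAction_apply_col, apply_move,
        col_move_of_ne _ _ _ _ hij]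
    have := (plusSubgroup (X i) (F i)).mul_mem ih h
    rwa [mul_inv_cancel_left] at this

theorem plusSubgroup_eq_of_universalGroup (hM : M.IsRightAngled) (hD : D.IsBuilding M)
    (hU : plusSubgroup C (L.universalGroup F) = L.universalGroup F) (i : I) :
    plusSubgroup (X i) (F i) = F i := by
  classical
  refine le_antisymm (plusSubgroup_le _ _) fun f hf => ?_
  obtain ⟨c⟩ := hD.nonempty
  let fs : ∀ j, Equiv.Perm (X j) := Function.update 1 i f
  have hfs : ∀ j, fs j ∈ F j := fun j => by
    rcases eq_or_ne j i with rfl | hj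
    · simpa [fs] using hf
    · simp [fs, hj]
  obtain ⟨g, -, -, hg⟩ := L.exists_aut hM hD fs c (L.move c i (f (L.col c i))) fun j => by
    rcases eq_or_ne j i with rfl | hj
    · simp [fs, col_move_self]
    · simp [fs, hj, L.col_move_of_ne]
  have h : g ∈ plusSubgroup C (L.universalGroup F) := by
    rw [hU]; intro j d; rw [hg]; exact hfs j
  have := L.localAction_mem_plusSubgroup F hD h i c
  rw [hg] at this
  simpa only [fs, Function.update_self] using this

/-- If a group-valued system of moves has weights that are invariant under the local groups, then
its invariant is constant on the orbits of `U⁺`. -/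
theorem moveHom_apply_eq (hD : D.IsBuilding M) {G : Type*} [Group G] {φ : ∀ i, X i → G}
    (hF : ∀ i, ∀ f ∈ F i, ∀ x, φ i (f x) = φ i x) {H : C → G}
    (hH : ∀ c i x, H (L.move c i x) = H c * ((φ i (L.col c i))⁻¹ * φ i x)) {g : D.Aut}
    (hg : g ∈ plusSubgroup C (L.universalGroup F)) (c : C) : H (g.1 c) = H c := by
  let K : Subgroup D.Aut :=
    { carrier := {g | ∀ c, H (g.1 c) = H c}
      one_mem' := fun _ => rfl
      mul_mem' := fun {g h} hg hh c => (hg (h.1 c)).trans (hh c)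
      inv_mem' := fun {g} hg c => by
        have h := hg (g⁻¹.1 c)
        have h2 : g.1 (g⁻¹.1 c) = c := g.1.apply_symm_apply c
        rw [h2] at h
        exact h.symm }
  suffices h : plusSubgroup C (L.universalGroup F) ≤ K from h hg c
  refine iSup_le fun c₀ g ⟨hg, hc₀⟩ => ?_
  replace hc₀ : g.1 c₀ = c₀ := hc₀
  refine L.move_induction hD c₀ (by rw [hc₀]) fun c i x ih => ?_
  rw [apply_move, hH, hH, ih, hF i _ (hg i c), ← localAction_apply_col, hF i _ (hg i c)]

/-- If both fail, an invariant of `U⁺`-orbits with values in the infinite dihedral group detects a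
commutator of moves that preserves all colours. -/
theorem isPretransitive_or_of_universalGroup (hM : M.IsRightAngled) (hD : D.IsBuilding M)
    (hU : plusSubgroup C (L.universalGroup F) = L.universalGroup F) {i j : I} (hij : M i j = 0) :
    MulAction.IsPretransitive (F i) (X i) ∨ MulAction.IsPretransitive (F j) (X j) := by
  classical
  by_contra! hcon
  have hne : i ≠ j := by rintro rfl; simp at hij
  have hji : M j i = 0 := (M.symmetric j i).trans hij
  have key : ∀ k, ¬ MulAction.IsPretransitive (F k) (X k) → ∃ (p : X k → Prop) (x y : X k),
      p x ∧ ¬ p y ∧ ∀ f ∈ F k, ∀ z, p (f z) ↔ p z := by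
    intro k hk
    obtain ⟨x, y, hxy⟩ : ∃ x y : X k, ∀ f : F k, f • x ≠ y := by
      by_contra! h
      exact hk ⟨h⟩
    refine ⟨fun z => z ∈ MulAction.orbit (F k) x, x, y, MulAction.mem_orbit_self x,
      fun ⟨f, hf⟩ => hxy f hf, fun f hf z => ?_⟩
    change (⟨f, hf⟩ : F k) • z ∈ MulAction.orbit (F k) x ↔ z ∈ MulAction.orbit (F k) x
    rw [← MulAction.orbit_eq_iff, MulAction.orbit_smul, MulAction.orbit_eq_iff]
  obtain ⟨p, x, x', hx, hx', hp⟩ := key i hcon.1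
  obtain ⟨q, y, y', hy, hy', hq⟩ := key j hcon.2
  let a : DihedralGroup 0 := .sr 0
  let b : DihedralGroup 0 := .sr 1
  -- The weights are constant on orbits of the local groups. Those of types `i` and `j` need not
  -- commute, as `m_ij = ∞`.
  let φ : ∀ k, X k → DihedralGroup 0 := Function.update
    (Function.update (fun _ _ => 1) i fun z => if p z then 1 else a) j
      fun z => if q z then 1 else b
  have hφi : φ i = fun z => if p z then 1 else a := by simp [φ, hne]
  have hφj : φ j = fun z => if q z then 1 else b := by simp [φ]
  have hφk : ∀ k, k ≠ i → k ≠ j → φ k = fun _ => 1 := fun k h1 h2 => by simp [φ, h1, h2]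
  have hcomm : ∀ k l, M k l = 2 → ∀ z w, Commute (φ k z) (φ l w) := by
    intro k l hkl z w
    by_cases hk : k ≠ i ∧ k ≠ j
    · rw [hφk k hk.1 hk.2]; exact Commute.one_left _
    by_cases hl : l ≠ i ∧ l ≠ j
    · rw [hφk l hl.1 hl.2]; exact Commute.one_right _
    exfalso
    have hk' : k = i ∨ k = j := by tauto
    have hl' : l = i ∨ l = j := by tauto
    rcases hk' with rfl | rfl <;> rcases hl' with rfl | rfl <;> simp_all
  obtain ⟨c₀⟩ := hD.nonempty
  set c := L.move (L.move c₀ i x) j y with hc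
  have hci : L.col c i = x := by rw [hc, col_move_of_ne _ _ _ _ hne, col_move_self]
  have hcj : L.col c j = y := by rw [hc, col_move_self]
  obtain ⟨H, H₀, Hm, Hc⟩ := L.exists_moveHom hM hD (MoveSystem.ofGroup φ hcomm) c (1, L.col c) rfl
  have hH : ∀ d k z, (H (L.move d k z)).1 = (H d).1 * ((φ k (L.col d k))⁻¹ * φ k z) := by
    intro d k z
    rw [Hm, ← Hc d]
    rfl
  -- This chamber has all colours of `c`, but its invariant is `a * b * a⁻¹ * b⁻¹`, the rotation `r
  -- 2`, which is nontrivial since `ZMod 0` is `ℤ`.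
  set d := L.move (L.move (L.move (L.move c i x') j y') i x) j y with hd
  obtain ⟨g, hgc, -, hg⟩ := L.exists_aut hM hD (fun _ => 1) c d fun k => by
    rw [Equiv.Perm.one_apply]
    rcases eq_or_ne k j with rfl | hkj
    · rw [hcj, hd, col_move_self]
    rcases eq_or_ne k i with rfl | hki
    · rw [hci, hd, col_move_of_ne _ _ _ _ hkj, col_move_self]
    · simp only [hd, col_move_of_ne _ _ _ _ hkj, col_move_of_ne _ _ _ _ hki]
  have hgU : g ∈ plusSubgroup C (L.universalGroup F) := by
    rw [hU]; intro k e; rw [hg]; exact (F k).one_mem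
  have hF : ∀ k, ∀ f ∈ F k, ∀ z, φ k (f z) = φ k z := by
    intro k f hf z
    rcases eq_or_ne k j with rfl | hkj
    · simp only [hφj, hq f hf]
    rcases eq_or_ne k i with rfl | hki
    · simp only [hφi, hp f hf]
    · rw [hφk k hki hkj]
  have h : (H (g.1 c)).1 = (H c).1 :=
    L.moveHom_apply_eq F hD hF (H := fun d => (H d).1) hH hgU c
  rw [hgc, hd, hH, hH, hH, hH, H₀] at h
  simp only [col_move_self, col_move_of_ne _ _ _ _ hne, col_move_of_ne _ _ _ _ hne.symm, hci, hcj,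
    hφi, hφj, if_pos hx, if_pos hy, if_neg hx', if_neg hy', inv_one, one_mul, mul_one] at h
  have h2 : (DihedralGroup.r (2 : ZMod 0) : DihedralGroup 0) = 1 := by
    rw [← h]
    rfl
  rw [DihedralGroup.one_def, DihedralGroup.r.injEq] at h2
  exact absurd h2 (by decide)

/-! ### Sufficiency: orbits of `U⁺`. -/

section Generation

variable (hM : M.IsRightAngled) (hD : D.IsBuilding M)
  (hF : ∀ i, plusSubgroup (X i) (F i) = F i)

/-- The relation of lying in the same orbit of `U⁺`. -/
def PlusRel (c d : C) : Prop := ∃ g ∈ plusSubgroup C (L.universalGroup F), g.1 c = d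

variable {L F}

theorem PlusRel.refl (c : C) : L.PlusRel F c c := ⟨1, Subgroup.one_mem _, rfl⟩

theorem PlusRel.symm {c d : C} : L.PlusRel F c d → L.PlusRel F d c := by
  rintro ⟨g, hg, rfl⟩
  exact ⟨g⁻¹, Subgroup.inv_mem _ hg, g.1.symm_apply_apply c⟩

theorem PlusRel.trans {c d e : C} : L.PlusRel F c d → L.PlusRel F d e → L.PlusRel F c e := by
  rintro ⟨g, hg, rfl⟩ ⟨h, hh, rfl⟩
  exact ⟨h * g, Subgroup.mul_mem _ hh hg, rfl⟩

include hM hD in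
theorem plusRel_move_of_mem_plusSubgroup {i : I} {f : Equiv.Perm (X i)}
    (hf : f ∈ plusSubgroup (X i) (F i)) (c : C) :
    L.PlusRel F c (L.move c i (f (L.col c i))) := by
  classical
  let K : Subgroup (Equiv.Perm (X i)) :=
    { carrier := {f | ∀ c, L.PlusRel F c (L.move c i (f (L.col c i)))}
      one_mem' := fun c => by rw [Equiv.Perm.one_apply, move_col]; exact PlusRel.refl c
      mul_mem' := fun {f g} hf hg c => by
        have h := (hg c).trans (hf _)
        rwa [col_move_self, move_move] at h
      inv_mem' := fun {f} hf c => by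
        have h := hf (L.move c i (f⁻¹ (L.col c i)))
        rw [col_move_self, move_move, ← Equiv.Perm.mul_apply, mul_inv_cancel, Equiv.Perm.one_apply, move_col] at h
        exact h.symm }
  suffices h : plusSubgroup (X i) (F i) ≤ K from h hf c
  refine iSup_le fun x f ⟨hf, hx⟩ c => ?_
  replace hx : f x = x := hx
  let fs : ∀ j, Equiv.Perm (X j) := Function.update 1 i f
  have hfs : ∀ j, fs j ∈ F j := fun j => by
    rcases eq_or_ne j i with rfl | hj
    · simpa [fs] using hf
    · simp [fs, hj]
  -- As `f` fixes `x`, it is realised by an automorphism fixing the chamber of colour `x` in the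
  -- `i`-panel of `c`, hence by an element of `U⁺`.
  obtain ⟨g, hgc, hgm, hg⟩ := L.exists_aut hM hD fs (L.move c i x) (L.move c i x) fun j => by
    rcases eq_or_ne j i with rfl | hj
    · simp [fs, col_move_self, hx]
    · simp [fs, hj]
  refine ⟨g, mem_plusSubgroup (fun j d => by rw [hg]; exact hfs j) hgc, ?_⟩
  have h := hgm (L.move c i x) i (L.col c i)
  rw [hgc, move_move, move_move, move_col] at h
  simpa only [fs, Function.update_self] using h

include hM hD hF in
theorem plusRel_move {i : I} {f : Equiv.Perm (X i)} (hf : f ∈ F i) (c : C) :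
    L.PlusRel F c (L.move c i (f (L.col c i))) :=
  plusRel_move_of_mem_plusSubgroup hM hD (by rwa [hF]) c

include hM hD hF in
theorem PlusRel.move {c d : C} (h : L.PlusRel F c d) {i : I} {f : Equiv.Perm (X i)}
    (hf : f ∈ F i) (x : X i) : L.PlusRel F (L.move c i x) (L.move d i (f x)) := by
  obtain ⟨g, hg, rfl⟩ := h
  have hσ := plusSubgroup_le _ _ hg i c
  -- Correct the colour by `σ⁻¹ * f` first, where `σ` is the local action of `g` at the panel of
  -- `c`; applying `g` then produces the colour `f x`.
  have h1 := plusRel_move (L := L) hM hD hF ((F i).mul_mem ((F i).inv_mem hσ) hf) (L.move c i x)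
  rw [col_move_self, move_move] at h1
  refine h1.trans ⟨g, hg, ?_⟩
  rw [apply_move, ← Equiv.Perm.mul_apply, mul_inv_cancel_left]

include hM hD hF in
theorem PlusRel.moves {l : List I} {z z' : ∀ i, X i} (hz : ∀ j ∈ l, ∃ f ∈ F j, f (z j) = z' j)
    {c d : C} (h : L.PlusRel F c d) : L.PlusRel F (L.moves c l z) (L.moves d l z') := by
  induction l generalizing c d with
  | nil => exact h
  | cons k l ih =>
    obtain ⟨f, hf, hk⟩ := hz k (by simp)
    rw [moves_cons, moves_cons, ← hk]
    exact ih (fun j hj => hz j (by simp [hj])) (h.move hM hD hF hf _)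

-- Induction along moves from `c`: a move of a type in `l` is matched by the same move on the right,
-- and a move of any other type stays in the `U⁺`-orbit by transitivity and leaves the right side
-- unchanged.
include hM hD hF in
theorem plusRel_moves {l : List I} (hl : l.Pairwise fun i j => M i j = 2)
    (ht : ∀ i ∉ l, MulAction.IsPretransitive (F i) (X i)) (c d : C) :
    L.PlusRel F d (L.moves c l (L.col d)) := by
  refine L.move_induction hD (p := fun d => L.PlusRel F d (L.moves c l (L.col d))) c
    (by rw [moves_col]; exact PlusRel.refl c) (fun d i x ih => ?_) d
  by_cases hi : i ∈ l
  · have h := ih.move hM hD hF (F i).one_mem x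
    rw [Equiv.Perm.one_apply] at h
    have h2 := L.move_moves hM hD c hl hi (z := L.col d) (z' := L.col (L.move d i x))
      fun k hk => L.col_move_of_ne d i x hk
    rw [col_move_self] at h2
    rwa [← h2]
  · have := ht i hi
    obtain ⟨f, hf⟩ := MulAction.exists_smul_eq (F i) (L.col d i) x
    have h := plusRel_move (L := L) hM hD hF f.2 d
    have hf' : f.1 (L.col d i) = x := hf
    rw [hf'] at h
    rw [L.moves_congr c (z' := L.col d) fun j hj =>
      L.col_move_of_ne d i x (by rintro rfl; exact hi hj)]
    exact h.symm.trans ih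

include hM hD hF in
theorem plusSubgroup_universalGroup_eq [Finite I] {V : Set I} (hV : M.diagram.IsVertexCover V)
    (ht : ∀ i ∈ V, MulAction.IsPretransitive (F i) (X i)) :
    plusSubgroup C (L.universalGroup F) = L.universalGroup F := by
  refine le_antisymm (plusSubgroup_le _ _) fun g hg => ?_
  obtain ⟨c⟩ := hD.nonempty
  -- The types outside a vertex cover are pairwise non-adjacent in the diagram, so they commute.
  let l : List I := (Set.toFinite Vᶜ).toFinset.toList
  have hmem : ∀ i, i ∈ l ↔ i ∉ V := fun i => by simp [l]
  have hl : l.Pairwise fun i j => M i j = 2 := by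
    refine (Finset.nodup_toList _).pairwise_of_forall_ne fun i hi j hj hij => ?_
    refine (hM i j hij).resolve_right fun h0 => ?_
    exact (hV (show M.diagram.Adj i j from h0)).elim ((hmem i).1 hi) ((hmem j).1 hj)
  have h1 := plusRel_moves (L := L) hM hD hF hl
    (fun i hi => ht i (not_not.1 fun h => hi ((hmem i).2 h))) c (g.1 c)
  -- The local action of `g` at `c` takes the colours of `c` to those of `g c`, so recolouring `c`
  -- accordingly stays in its `U⁺`-orbit.
  have h2 := (PlusRel.refl c : L.PlusRel F c c).moves hM hD hF (l := l) (z := L.col c)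
    (z' := L.col (g.1 c)) fun j _ => ⟨_, hg j c, L.localAction_apply_col g j c⟩
  rw [moves_col] at h2
  obtain ⟨h, hh, hhc⟩ := h1.trans h2.symm
  have h3 : h * g ∈ plusSubgroup C (L.universalGroup F) :=
    mem_plusSubgroup (mul_mem (plusSubgroup_le _ _ hh) hg) (y := c) hhc
  exact (Subgroup.mul_mem_cancel_left _ hh).1 h3

end Generation

end LegalColouring

end ChamberSystem

theorem mainTheorem2 {I C : Type*} [Finite I] (M : CoxeterMatrix I) (hM : M.IsRightAngled)
    (D : ChamberSystem I C) (hD : D.IsBuilding M) {X : I → Type*} (L : D.LegalColouring X)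
    (F : ∀ i, Subgroup (Equiv.Perm (X i))) :
    plusSubgroup C (L.universalGroup F) = L.universalGroup F ↔
      (∀ i, plusSubgroup (X i) (F i) = F i) ∧
        ∃ V : Set I, M.diagram.IsVertexCover V ∧
          ∀ i ∈ V, MulAction.IsPretransitive (F i) (X i) := by
  constructor
  · intro hU
    exact ⟨L.plusSubgroup_eq_of_universalGroup F hM hD hU,
      {i | MulAction.IsPretransitive (F i) (X i)},
      fun i j hij => L.isPretransitive_or_of_universalGroup F hM hD hU hij, fun i hi => hi⟩
  · rintro ⟨hF, V, hV, ht⟩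
    exact ChamberSystem.LegalColouring.plusSubgroup_universalGroup_eq hM hD hF hV ht
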